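/- **Energy constraint limits the accuracy of thermal catalysis.** Fix an inverse temperature $\beta>0$. Let $S$ be a finite-dimensional system of dimension $m\ge 2$ with Hamiltonian $H_S=\sum_s E^S_s|s\rangle\langle s|$, let $|E^S_{\max}\rangle$ be one of these energy eigenstates whose energy $E^S_{\max}$ is maximal, and let $\tau_S=e^{-\beta H_S}/Z_S$ with $Z_S=\operatorname{tr}e^{-\beta H_S}$. Let $C$ be a catalyst with Hamiltonian $H_C=\sum_{j\ge 1}E^C_j|j\rangle\langle j|$ on $\ell^2(\mathbb N)$, where $0\le E^C_1\le E^C_2\le\cdots$, $E^C_j\to\infty$, and $Z_C=\sum_j e^{-\beta E^C_j}<\infty$. For states $\rho,\rho'$ of $CS$ write $\rho\to\rho'$ if $\rho'$ arises from $\rho$ by a thermal operation: there are a bath $B$ with Hamiltonian $H_B$ and finite partition function, with thermal state $\tau_B$ at inverse temperature $\beta$, and a unitary $U$ on $CSB$ commuting with $H_C+H_S+H_B$, such that $\rho'=\operatorname{tr}_B\!\left[U(\rho\otimes\tau_B)U^\dagger\right]$. Let $E\in\mathbb R$, $\gamma=e^{-\beta/2}$, $A=Z_S/e^{-\beta E^S_{\max}}$,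 $f(a)=\dfrac{a^2}{2(a^2+1)}$, $j(W)=\min\{j\ge 1: E^C_{j+1}>E/(1-W)\}$ for $W\in(0,1)$, and $$\varepsilon_C=\sup_{W\in(0,1)}W\,\gamma^{E^C_{j(W)}} .$$ 1. If $\omega_C,\omega_C'$ are density operators of the catalyst (not necessarily diagonal), $\operatorname{tr}(H_C\,\omega_C)\le E$, and $\omega_C\otimes\tau_S\to\omega_C'\otimes|E^S_{\max}\rangle\langle E^S_{\max}|$, then $$\tfrac12\|\omega_C-\omega_C'\|_1\;\ge\;\frac12\,\frac{f(A)^2\,\varepsilon_C^2}{Z_C}\;>\;0 ,$$ and the right-hand side is positive for every $E$. 2. Consequently, arbitrarily accurate thermal embezzling of diagonal states is impossible: it is not the case that for every $\delta>0$ there are density operators $\omega_C,\omega_C'$ of the catalyst with $\operatorname{tr}(H_C\,\omega_C)\le E$ and $\tfrac12\|\omega_C-\omega_C'\|_1<\delta$ such that $\omega_C\otimes\rho_S\to\omega_C'\otimes\rho_S'$ for all states $\rho_S,\rho_S'$ of $S$ that are diagonal in the basis $\{|s\rangle\}$. -/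

import Mathlib

open Filter Topology
open scoped ENNReal

noncomputable section

namespace ThermalEmbezzling

/-- The Hilbert space `ℓ²(X)` of a quantum system with an orthonormal energy eigenbasis labelled by
`X`. The tensor product of `ℓ²(X)` and `ℓ²(Y)` is `ℓ²(X × Y)`. -/
abbrev HilbertSpace (X : Type*) : Type _ := lp (fun _ : X => ℂ) 2

/-- Bounded operators on `ℓ²(X)`. -/
abbrev Op (X : Type*) : Type _ := HilbertSpace X →L[ℂ] HilbertSpace X

/-- The basis vector `|x⟩`. -/
def ket {X : Type*} (x : X) : HilbertSpace X :=
  haveI := Classical.decEq X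
  lp.single 2 x (1 : ℂ)

/-- The matrix element `⟨x| T |y⟩`, the `x`-th coordinate of `T |y⟩`. -/
def matElem {X : Type*} (T : Op X) (x y : X) : ℂ := T (ket y) x

/-- A density operator: a positive operator of trace one. -/
def IsDensity {X : Type*} (ρ : Op X) : Prop :=
  ρ.IsPositive ∧ HasSum (fun x => matElem ρ x x) 1

/-- The absolute value `|T| = √(T† T)` of a bounded operator on a complex Hilbert space. -/
def absOp {H : Type*} [NormedAddCommGroup H] [InnerProductSpace ℂ H] [CompleteSpace H]
    (T : H →L[ℂ] H) : H →L[ℂ] H := CFC.abs T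

/-- The trace norm `‖T‖₁ = tr |T|`. -/
def traceNorm {X : Type*} (T : Op X) : ℝ≥0∞ :=
  ∑' x, ENNReal.ofReal (matElem (absOp T) x x).re

/-- The trace distance `½ ‖ρ - σ‖₁`. -/
def traceDist {X : Type*} (ρ σ : Op X) : ℝ≥0∞ := traceNorm (ρ - σ) / 2

open Classical in
theorem embedKet_memℓp {X Y : Type*} (y : Y) (f : HilbertSpace X) :
    Memℓp (fun z : X × Y => if z.2 = y then f z.1 else (0 : ℂ)) 2 := by
  have h2 : (0 : ℝ) < (2 : ℝ≥0∞).toReal := by norm_num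
  rw [memℓp_gen_iff h2]
  have hf := (memℓp_gen_iff h2).1 f.2
  have hinj : Function.Injective (fun x : X => (x, y)) := fun a b h => (Prod.mk.inj h).1
  refine (hinj.summable_iff ?_).1 ?_
  · rintro ⟨x, y'⟩ hz
    have : y' ≠ y := fun h => hz ⟨x, by rw [h]⟩
    simp [this]
  · simpa [Function.comp_def] using hf

open Classical in
theorem embedKet_norm {X Y : Type*} (y : Y) (f : HilbertSpace X) :
    ‖(⟨_, embedKet_memℓp y f⟩ : HilbertSpace (X × Y))‖ = ‖f‖ := by
  have h2 : (0 : ℝ) < (2 : ℝ≥0∞).toReal := by norm_num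
  rw [lp.norm_eq_tsum_rpow h2, lp.norm_eq_tsum_rpow h2]
  congr 1
  have hinj : Function.Injective (fun x : X => (x, y)) := fun a b h => (Prod.mk.inj h).1
  rw [← hinj.tsum_eq]
  · simp
  · rintro ⟨x, y'⟩ hz
    by_cases h : y' = y
    · exact ⟨x, by rw [h]⟩
    · simp [h] at hz

open Classical in
/-- The isometry `ψ ↦ ψ ⊗ |y⟩` from `ℓ²(X)` to `ℓ²(X × Y)`. -/
def embedKet {X Y : Type*} (y : Y) : HilbertSpace X →L[ℂ] HilbertSpace (X × Y) :=
  LinearMap.mkContinuous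
    { toFun := fun f => ⟨fun z => if z.2 = y then f z.1 else 0, embedKet_memℓp y f⟩
      map_add' := by
        intro f g
        ext z
        change (if z.2 = y then f z.1 + g z.1 else 0)
          = (if z.2 = y then f z.1 else 0) + (if z.2 = y then g z.1 else 0)
        split_ifs <;> simp
      map_smul' := by
        intro c f
        ext z
        change (if z.2 = y then c * f z.1 else 0) = c * (if z.2 = y then f z.1 else 0)
        split_ifs <;> simp }
    1 (fun f => by simpa using (embedKet_norm y f).le)

/-- The operator `ρ ⊗ ∑ y, p y |y⟩⟨y|` on `ℓ²(X × Y)`: the tensor product of `ρ` with the state that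
is diagonal in the energy eigenbasis with populations `p`. The series converges in operator norm
whenever `p` is summable. -/
def tensorDiag {X Y : Type*} (ρ : Op X) (p : Y → ℝ) : Op (X × Y) :=
  ∑' y, (p y : ℂ) • (embedKet y ∘L ρ ∘L ContinuousLinearMap.adjoint (embedKet y))

/-- `ρ` is the partial trace of `T` over the second factor. For trace-class `T` the series converges
absolutely in operator norm. -/
def IsPartialTrace {X Y : Type*} (T : Op (X × Y)) (ρ : Op X) : Prop :=
  HasSum (fun y : Y => ContinuousLinearMap.adjoint (embedKet y) ∘L T ∘L embedKet y) ρ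

/-- The partition function of the Hamiltonian `∑ x, E x |x⟩⟨x|` at inverse temperature `β`. -/
def partitionFn {X : Type*} (β : ℝ) (E : X → ℝ) : ℝ := ∑' x, Real.exp (-β * E x)

/-- The populations of the thermal state of the Hamiltonian `∑ x, E x |x⟩⟨x|`. -/
def gibbs {X : Type*} (β : ℝ) (E : X → ℝ) (x : X) : ℝ := Real.exp (-β * E x) / partitionFn β E

/-- The operator `U` commutes with the Hamiltonian `∑ x, E x |x⟩⟨x|`: it has no matrix elements
between eigenvectors of different energy. -/
def CommutesWithHamiltonian {X : Type*} (E : X → ℝ) (U : Op X) : Prop :=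
  ∀ x y, E x ≠ E y → matElem U x y = 0

/-- `ρ → ρ'` by a thermal operation at inverse temperature `β`, for a system with Hamiltonian
`∑ x, E x |x⟩⟨x|`: attach a bath `B` in its thermal state, apply a unitary that commutes with the
total Hamiltonian, and trace out the bath. The bath is any system whose partition function is
finite; its Hamiltonian then has an eigenbasis labelled by a countable type. -/
def ThermalTransition {X : Type*} (β : ℝ) (E : X → ℝ) (ρ ρ' : Op X) : Prop :=
  ∃ (B : Type) (_ : Nonempty B) (EB : B → ℝ) (_ : Summable fun b => Real.exp (-β * EB b))
    (U : Op (X × B)), U ∈ unitary (Op (X × B)) ∧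
      CommutesWithHamiltonian (fun z : X × B => E z.1 + EB z.2) U ∧
      IsPartialTrace (U ∘L tensorDiag ρ (gibbs β EB) ∘L ContinuousLinearMap.adjoint U) ρ'

/-- The energy levels of the noninteracting Hamiltonian `H_C + H_S`. -/
def jointEnergy {X Y : Type*} (EC : X → ℝ) (ES : Y → ℝ) : X × Y → ℝ := fun z => EC z.1 + ES z.2

/-- The mean energy `tr (H ω)` is finite and at most `e`. -/
def MeanEnergyLE {X : Type*} (E : X → ℝ) (ω : Op X) (e : ℝ) : Prop :=
  Summable (fun x => E x * (matElem ω x x).re) ∧ ∑' x, E x * (matElem ω x x).re ≤ e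

/-- The populations of the pure state `|s⟩⟨s|`. -/
def pureState {Y : Type*} (s : Y) : Y → ℝ :=
  haveI := Classical.decEq Y
  Pi.single s 1

/-- A probability distribution on a finite set, read as a state diagonal in the energy eigenbasis. -/
def IsProbability {Y : Type*} [Fintype Y] (p : Y → ℝ) : Prop := (∀ s, 0 ≤ p s) ∧ ∑ s, p s = 1

/-- `f(a) = a² / (2 (a² + 1))`. -/
def f (a : ℝ) : ℝ := a ^ 2 / (2 * (a ^ 2 + 1))

/-- With the levels numbered from zero, `E (cutoff E e W)` is the energy `E_{j(W)}` of the level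
`j(W) = min {j : E_{j+1} > e / (1 - W)}`. -/
def cutoff (E : ℕ → ℝ) (e W : ℝ) : ℕ := sInf {k | e / (1 - W) < E (k + 1)}

/-- `ε_C = sup_{W ∈ (0,1)} W γ^{E_{j(W)}}` with `γ = e^{-β/2}`. -/
def epsC (β : ℝ) (E : ℕ → ℝ) (e : ℝ) : ℝ :=
  ⨆ W : Set.Ioo (0 : ℝ) 1, (W : ℝ) * Real.exp (-β / 2) ^ E (cutoff E e W)

/-- The bound `½ f(A)² ε_C² / Z_C` with `A = Z_S / e^{-β E_max}`. -/
def errorBound {Y : Type*} (β : ℝ) (EC : ℕ → ℝ) (ES : Y → ℝ) (sMax : Y) (e : ℝ) : ℝ :=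
  1 / 2 * (f (partitionFn β ES / Real.exp (-β * ES sMax)) ^ 2 * epsC β EC e ^ 2
    / partitionFn β EC)

end ThermalEmbezzling

end

/-! ### Expectation values of positive operators and Bessel families -/

namespace ThermalEmbezzling

open ContinuousLinearMap (adjoint)

variable {X Y : Type*}

/-! Work in the Heisenberg picture. A test on the catalyst is M = ∑ |v i⟩⟨v i| ≤ 1, stored as a
Bessel family `v`. If ω ⊗ τ goes to ω' ⊗ |s₀⟩⟨s₀|, pulling back M ⊗ |s₀⟩⟨s₀| along the thermal
operation gives a test M' with tr(ω M') = tr(ω' M). Let g be the thermal state of the catalyst.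
Since g ⊗ τ ⊗ τ_B commutes with U, tr(g M') = τ(s₀) tr(g M), and τ(s₀) ≤ 1/2 at the top level of a
system of dimension at least two.

Start from M = 1 and iterate n times. The thermal weight shrinks to τ(s₀)^n ≤ 2⁻ⁿ. Each step costs ω
at most the trace distance d in probability, so ω still passes with probability at least 1 - n d
(`exists_isBessel_diagWeight_eq`).

A state of bounded energy cannot do this for long. By Markov it has mass at most 1 - W above level J
= j(W). The vectors of the test remain energy eigenvectors, so those not wholly above J have support
where g ≥ g_J, and they contribute at most tr(g M)/g_J (`IsBessel.tsum_quadForm_le_diagWeight`).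
Hence W ≤ n d + 2⁻ⁿ/g_J for all n. Choosing 2ⁿ of order 1/(W g_J) yields W² g_J ≤ 8 d, and the
supremum over W gives the bound, using only f ≤ 1/2. No diagonality of ω or ω' is needed.

Expectations and weights take values in `ℝ≥0∞`, so that sums can be exchanged freely. -/

theorem ofReal_norm_sq {H : Type*} [NormedAddCommGroup H] (u : H) :
    ENNReal.ofReal (‖u‖ ^ 2) = ‖u‖ₑ ^ 2 := by
  rw [ENNReal.ofReal_pow (norm_nonneg u), ofReal_norm]

theorem enorm_inner_comm {H : Type*} [NormedAddCommGroup H] [InnerProductSpace ℂ H] (u v : H) :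
    ‖inner ℂ u v‖ₑ = ‖inner ℂ v u‖ₑ := by
  rw [← ofReal_norm, ← ofReal_norm, norm_inner_symm]

theorem enorm_sq_eq_tsum (u : HilbertSpace X) : ‖u‖ₑ ^ 2 = ∑' x, ‖u x‖ₑ ^ 2 := by
  have h2 : (0 : ℝ) < (2 : ℝ≥0∞).toReal := by norm_num
  have h := lp.hasSum_norm h2 u
  have h' : HasSum (fun x => ‖u x‖ ^ 2) (‖u‖ ^ 2) := by
    simpa only [ENNReal.toReal_ofNat, Real.rpow_ofNat] using h
  rw [← ofReal_norm_sq, ← h'.tsum_eq, ENNReal.ofReal_tsum_of_nonneg (fun x => by positivity)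
    h'.summable]
  simp only [ofReal_norm_sq]

theorem ket_apply (x y : X) [Decidable (y = x)] : (ket x : HilbertSpace X) y = if y = x then 1 else 0 := by
  classical
  unfold ket
  rw [lp.single_apply, Pi.single_apply]
  congr

theorem inner_ket_left (x : X) (u : HilbertSpace X) : inner ℂ (ket x) u = u x := by
  classical
  unfold ket
  rw [lp.inner_single_left]
  simp

theorem matElem_eq_inner (T : Op X) (x y : X) : matElem T x y = inner ℂ (ket x) (T (ket y)) :=
  (inner_ket_left _ _).symm

/-- Supplies coordinate projections and square roots of functions of energy as bounded multipliers.
-/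
theorem exists_diagMul (c : X → ℝ) {C : ℝ} (hc : ∀ x, |c x| ≤ C) (u : HilbertSpace X) :
    ∃ w : HilbertSpace X, ∀ x, w x = c x * u x := by
  have h2 : (0 : ℝ) < (2 : ℝ≥0∞).toReal := by norm_num
  have hu := (memℓp_gen_iff h2).1 u.2
  refine ⟨⟨fun x => c x * u x, (memℓp_gen_iff h2).2 ?_⟩, fun x => rfl⟩
  refine Summable.of_nonneg_of_le (fun x => by positivity) (fun x => ?_) (hu.mul_left (C ^ 2))
  have h1 : ‖(c x : ℂ) * u x‖ = |c x| * ‖u x‖ := by simp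
  have h3 : |c x| ^ 2 ≤ C ^ 2 := pow_le_pow_left₀ (abs_nonneg _) (hc x) 2
  simp only [h1, ENNReal.toReal_ofNat, Real.rpow_ofNat, mul_pow]
  exact mul_le_mul_of_nonneg_right h3 (by positivity)

open Classical in
theorem embedKet_apply (y : Y) (u : HilbertSpace X) (z : X × Y) :
    embedKet y u z = if z.2 = y then u z.1 else 0 := rfl

theorem norm_embedKet (y : Y) (u : HilbertSpace X) : ‖embedKet y u‖ = ‖u‖ := embedKet_norm y u

theorem embedKet_ket (x : X) (y : Y) : embedKet y (ket x) = ket (x, y) := by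
  classical
  ext z
  rw [embedKet_apply, ket_apply, ket_apply]
  by_cases h : z.2 = y <;> by_cases h' : z.1 = x <;> simp [h, h', Prod.ext_iff]

theorem adjoint_embedKet_apply (y : Y) (w : HilbertSpace (X × Y)) (x : X) :
    adjoint (embedKet y) w x = w (x, y) := by
  rw [← inner_ket_left, ContinuousLinearMap.adjoint_inner_right, embedKet_ket, inner_ket_left]

theorem tsum_enorm_adjoint_embedKet (w : HilbertSpace (X × Y)) :
    ∑' y, ‖adjoint (embedKet y : HilbertSpace X →L[ℂ] _) w‖ₑ ^ 2 = ‖w‖ₑ ^ 2 := by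
  simp only [enorm_sq_eq_tsum, adjoint_embedKet_apply]
  rw [ENNReal.tsum_comm, ENNReal.tsum_prod']

/-- The expectation value `⟨v| T |v⟩` of a positive operator. -/
noncomputable def quadForm {H : Type*} [NormedAddCommGroup H] [InnerProductSpace ℂ H] (T : H →L[ℂ] H) (v : H) :
    ℝ≥0∞ :=
  ENNReal.ofReal (T.reApplyInnerSelf v)

section QuadForm

variable {H K : Type*} [NormedAddCommGroup H] [InnerProductSpace ℂ H]
  [NormedAddCommGroup K] [InnerProductSpace ℂ K]

theorem quadForm_comp_adjoint [CompleteSpace H] [CompleteSpace K]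
    (T : H →L[ℂ] H) (V : H →L[ℂ] K) (w : K) :
    quadForm (V ∘L T ∘L adjoint V) w = quadForm T (adjoint V w) := by
  simp only [quadForm, ContinuousLinearMap.reApplyInnerSelf_apply, ContinuousLinearMap.comp_apply]
  rw [← ContinuousLinearMap.adjoint_inner_right]

theorem quadForm_adjoint_comp [CompleteSpace H] [CompleteSpace K]
    (T : K →L[ℂ] K) (V : H →L[ℂ] K) (w : H) :
    quadForm (adjoint V ∘L T ∘L V) w = quadForm T (V w) := by
  simp only [quadForm, ContinuousLinearMap.reApplyInnerSelf_apply, ContinuousLinearMap.comp_apply]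
  rw [ContinuousLinearMap.adjoint_inner_left]

theorem quadForm_real_smul (T : H →L[ℂ] H) {c : ℝ} (hc : 0 ≤ c) (v : H) :
    quadForm ((c : ℂ) • T) v = ENNReal.ofReal c * quadForm T v := by
  simp only [quadForm, ContinuousLinearMap.reApplyInnerSelf_apply]
  rw [← ENNReal.ofReal_mul hc, smul_apply, inner_smul_left,
    Complex.conj_ofReal]
  simp

theorem quadForm_apply_smul (T : H →L[ℂ] H) {c : ℝ} (v : H) :
    quadForm T ((c : ℂ) • v) = ENNReal.ofReal (c ^ 2) * quadForm T v := by
  simp only [quadForm, ContinuousLinearMap.reApplyInnerSelf_apply]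
  rw [← ENNReal.ofReal_mul (by positivity), map_smul, inner_smul_left, inner_smul_right,
    Complex.conj_ofReal]
  simp [sq, mul_assoc]

theorem quadForm_eq_tsum {ι : Type*} {T : ι → H →L[ℂ] H} {A : H →L[ℂ] H} (hT : HasSum T A)
    {v : H} (hpos : ∀ i, 0 ≤ (T i).reApplyInnerSelf v) :
    quadForm A v = ∑' i, quadForm (T i) v := by
  let φ : (H →L[ℂ] H) →L[ℝ] ℝ := Complex.reCLM ∘L
    ((innerSL ℂ v : H →L[ℂ] ℂ) ∘L ContinuousLinearMap.apply ℂ H v).restrictScalars ℝ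
  have hφ : ∀ S : H →L[ℂ] H, φ S = S.reApplyInnerSelf v := by
    intro S
    rw [ContinuousLinearMap.reApplyInnerSelf_apply, inner_re_symm]
    rfl
  have h : HasSum (fun i => (T i).reApplyInnerSelf v) (A.reApplyInnerSelf v) := by
    simpa only [← hφ] using hT.mapL φ
  simp only [quadForm]
  rw [← h.tsum_eq, ENNReal.ofReal_tsum_of_nonneg hpos h.summable]

theorem quadForm_add {T S : H →L[ℂ] H} (hT : T.IsPositive) (hS : S.IsPositive) (v : H) :
    quadForm (T + S) v = quadForm T v + quadForm S v := by
  have h1 := hT.2 v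
  have h2 := hS.2 v
  rw [quadForm, quadForm, quadForm, ← ENNReal.ofReal_add h1 h2]
  simp [ContinuousLinearMap.reApplyInnerSelf_apply, inner_add_left]

theorem quadForm_mono {T S : H →L[ℂ] H} (h : T ≤ S) (v : H) : quadForm T v ≤ quadForm S v := by
  have h1 := ((ContinuousLinearMap.le_def T S).1 h).2 v
  apply ENNReal.ofReal_le_ofReal
  simp [ContinuousLinearMap.reApplyInnerSelf_apply, inner_sub_left] at h1 ⊢
  exact h1

theorem exists_quadForm_eq_enorm_sq [CompleteSpace H] {T : H →L[ℂ] H} (hT : T.IsPositive) :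
    ∃ R : H →L[ℂ] H, adjoint R = R ∧ ∀ v, quadForm T v = ‖R v‖ₑ ^ 2 := by
  have h0 : 0 ≤ T := (ContinuousLinearMap.nonneg_iff_isPositive T).2 hT
  refine ⟨CFC.sqrt T, ?_, fun v => ?_⟩
  · exact (IsSelfAdjoint.of_nonneg (CFC.sqrt_nonneg T)).star_eq
  · have h1 : adjoint (CFC.sqrt T) = CFC.sqrt T :=
      (IsSelfAdjoint.of_nonneg (CFC.sqrt_nonneg T)).star_eq
    have h2 : CFC.sqrt T * CFC.sqrt T = T := CFC.sqrt_mul_sqrt_self T h0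
    rw [← ofReal_norm_sq, ← inner_self_eq_norm_sq (𝕜 := ℂ), quadForm,
      ContinuousLinearMap.reApplyInnerSelf_apply, ← ContinuousLinearMap.adjoint_inner_left, h1]
    nth_rewrite 1 [← h2]
    rfl

end QuadForm

theorem quadForm_ket (T : Op X) (x : X) : quadForm T (ket x) = ENNReal.ofReal (matElem T x x).re := by
  rw [matElem_eq_inner, quadForm, ContinuousLinearMap.reApplyInnerSelf_apply, inner_re_symm]
  rfl

/-- With T = R², expand R u in the basis and apply Cauchy–Schwarz to ⟨x|R u⟩ = ⟨R x|u⟩. -/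
theorem quadForm_le_trace_mul {T : Op X} (hT : T.IsPositive) (u : HilbertSpace X) :
    quadForm T u ≤ (∑' x, quadForm T (ket x)) * ‖u‖ₑ ^ 2 := by
  obtain ⟨R, hR, hq⟩ := exists_quadForm_eq_enorm_sq hT
  simp only [hq]
  rw [enorm_sq_eq_tsum (R u), ← ENNReal.tsum_mul_right]
  refine ENNReal.tsum_le_tsum fun x => ?_
  rw [← inner_ket_left, ← hR, ContinuousLinearMap.adjoint_inner_right, hR, ← mul_pow,
    ← ofReal_norm_sq, ← ofReal_norm, ← ofReal_norm, ← ENNReal.ofReal_mul (norm_nonneg _),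
    ← ENNReal.ofReal_pow (by positivity)]
  exact ENNReal.ofReal_le_ofReal (pow_le_pow_left₀ (norm_nonneg _) (norm_inner_le_norm _ _) 2)

/-- A Bessel family: `∑ i, |v i⟩⟨v i| ≤ 1`. -/
def IsBessel {ι : Type*} (v : ι → HilbertSpace X) : Prop :=
  ∀ u, ∑' i, ‖inner ℂ (v i) u‖ₑ ^ 2 ≤ ‖u‖ₑ ^ 2

theorem isBessel_ket : IsBessel (ket : X → HilbertSpace X) := fun u => by
  simp only [inner_ket_left, enorm_sq_eq_tsum u, le_refl]

/-- The expectation of a positive operator in a Bessel family supported on `s` is at most its trace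
over `s`. -/
theorem IsBessel.tsum_quadForm_le {ι : Type*} {v : ι → HilbertSpace X} (hv : IsBessel v)
    {T : Op X} (hT : T.IsPositive) (s : Set X) (hs : ∀ i, ∀ x ∉ s, v i x = 0) :
    ∑' i, quadForm T (v i) ≤ ∑' x, s.indicator (fun x => quadForm T (ket x)) x := by
  classical
  obtain ⟨R, hR, hq⟩ := exists_quadForm_eq_enorm_sq hT
  have hmask : ∀ u : HilbertSpace X, ∃ w : HilbertSpace X,
      ∀ x, w x = (s.indicator (fun _ => (1 : ℝ)) x : ℝ) * u x := fun u =>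
    exists_diagMul _ (C := 1) (fun x => by by_cases h : x ∈ s <;> simp [h]) u
  choose Q hQ using hmask
  have hinner : ∀ i u, inner ℂ (v i) u = inner ℂ (v i) (Q u) := by
    intro i u
    rw [lp.inner_eq_tsum, lp.inner_eq_tsum]
    refine tsum_congr fun x => ?_
    rw [hQ]
    by_cases h : x ∈ s
    · simp [h]
    · simp [hs i x h]
  have hadj : ∀ u w : HilbertSpace X, inner ℂ (R u) w = inner ℂ u (R w) := fun u w => by
    rw [← ContinuousLinearMap.adjoint_inner_right, hR]
  -- Here Q projects onto the coordinates in `s`. After the Bessel bound, what remains is the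
  -- squared Hilbert–Schmidt norm of Q R, summed first by columns and then by rows.
  calc ∑' i, quadForm T (v i)
      = ∑' i, ∑' y, ‖inner ℂ (v i) (Q (R (ket y)))‖ₑ ^ 2 := by
        refine tsum_congr fun i => ?_
        rw [hq, enorm_sq_eq_tsum]
        refine tsum_congr fun y => ?_
        rw [← hinner, ← hadj, enorm_inner_comm, inner_ket_left]
    _ = ∑' y, ∑' i, ‖inner ℂ (v i) (Q (R (ket y)))‖ₑ ^ 2 := ENNReal.tsum_comm
    _ ≤ ∑' y, ‖Q (R (ket y))‖ₑ ^ 2 := ENNReal.tsum_le_tsum fun y => hv _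
    _ = ∑' y, ∑' x, ‖Q (R (ket y)) x‖ₑ ^ 2 := by simp only [enorm_sq_eq_tsum]
    _ = ∑' x, ∑' y, ‖Q (R (ket y)) x‖ₑ ^ 2 := ENNReal.tsum_comm
    _ = ∑' x, s.indicator (fun x => quadForm T (ket x)) x := by
        refine tsum_congr fun x => ?_
        by_cases h : x ∈ s
        · rw [Set.indicator_of_mem h, hq, enorm_sq_eq_tsum]
          refine tsum_congr fun y => ?_
          rw [hQ, Set.indicator_of_mem h, ← inner_ket_left, ← inner_ket_left, ← hadj,
            enorm_inner_comm]
          simp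
        · simp [hQ, h]

theorem IsBessel.tsum_quadForm_le_trace {ι : Type*} {v : ι → HilbertSpace X} (hv : IsBessel v)
    {T : Op X} (hT : T.IsPositive) : ∑' i, quadForm T (v i) ≤ ∑' x, quadForm T (ket x) := by
  simpa using hv.tsum_quadForm_le hT Set.univ (by simp)

end ThermalEmbezzling

/-! ### Thermal operations in the Heisenberg picture -/

namespace ThermalEmbezzling

open ContinuousLinearMap (adjoint)

variable {X Y S B : Type*}

theorem norm_embedKet_le (y : Y) : ‖(embedKet y : HilbertSpace X →L[ℂ] HilbertSpace (X × Y))‖ ≤ 1 :=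
  ContinuousLinearMap.opNorm_le_bound _ zero_le_one fun u => by rw [norm_embedKet, one_mul]

/-- Ensures that the `tsum` defining `tensorDiag` is a genuine sum and not the default value 0. -/
theorem summable_tensorDiag (ρ : Op X) {p : Y → ℝ} (hp : ∀ y, 0 ≤ p y) (hs : Summable p) :
    Summable fun y => (p y : ℂ) • (embedKet y ∘L ρ ∘L adjoint (embedKet y)) := by
  refine Summable.of_norm_bounded (hs.mul_right ‖ρ‖) fun y => ?_
  rw [norm_smul, Complex.norm_real, Real.norm_of_nonneg (hp y)]
  refine mul_le_mul_of_nonneg_left ?_ (hp y)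
  have h1 := norm_embedKet_le (X := X) y
  have h2 : ‖adjoint (embedKet y : HilbertSpace X →L[ℂ] HilbertSpace (X × Y))‖ ≤ 1 := by
    rwa [LinearIsometryEquiv.norm_map]
  calc _ ≤ ‖(embedKet y : HilbertSpace X →L[ℂ] HilbertSpace (X × Y))‖ *
        (‖ρ‖ * ‖adjoint (embedKet y : HilbertSpace X →L[ℂ] HilbertSpace (X × Y))‖) :=
        (ContinuousLinearMap.opNorm_comp_le _ _).trans
          (mul_le_mul_of_nonneg_left (ContinuousLinearMap.opNorm_comp_le _ _) (norm_nonneg _))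
    _ ≤ 1 * (‖ρ‖ * 1) := by gcongr
    _ = ‖ρ‖ := by ring

theorem isPositive_tensorDiag_summand {ρ : Op X} (hρ : ρ.IsPositive) {p : Y → ℝ}
    (hp : ∀ y, 0 ≤ p y) (y : Y) :
    ((p y : ℂ) • (embedKet y ∘L ρ ∘L adjoint (embedKet y))).IsPositive :=
  (hρ.conj_adjoint _).smul_of_nonneg (by exact_mod_cast hp y)

theorem isPositive_tensorDiag {ρ : Op X} (hρ : ρ.IsPositive) {p : Y → ℝ} (hp : ∀ y, 0 ≤ p y) :
    (tensorDiag ρ p).IsPositive := by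
  rw [← ContinuousLinearMap.nonneg_iff_isPositive]
  -- Summability is not needed: the default value 0 is positive too.
  exact tsum_nonneg fun y => (ContinuousLinearMap.nonneg_iff_isPositive _).2
    (isPositive_tensorDiag_summand hρ hp y)

theorem quadForm_tensorDiag {ρ : Op X} (hρ : ρ.IsPositive) {p : Y → ℝ} (hp : ∀ y, 0 ≤ p y)
    (hs : Summable p) (w : HilbertSpace (X × Y)) :
    quadForm (tensorDiag ρ p) w
      = ∑' y, ENNReal.ofReal (p y) * quadForm ρ (adjoint (embedKet y) w) := by
  rw [tensorDiag, quadForm_eq_tsum (summable_tensorDiag ρ hp hs).hasSum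
    fun y => (isPositive_tensorDiag_summand hρ hp y).2 w]
  simp only [quadForm_real_smul _ (hp _), quadForm_comp_adjoint]

open Classical in
theorem adjoint_embedKet_embedKet (y y' : Y) (u : HilbertSpace X) :
    adjoint (embedKet y) (embedKet y' u) = if y = y' then u else 0 := by
  ext x
  rw [adjoint_embedKet_apply, embedKet_apply]
  split_ifs <;> rfl

theorem pureState_nonneg (s t : S) : 0 ≤ pureState s t := by
  classical
  unfold pureState
  rw [Pi.single_apply]
  split_ifs <;> simp

theorem quadForm_tensorDiag_pureState [Fintype S] {ρ : Op X} (hρ : ρ.IsPositive) (s : S)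
    (u : HilbertSpace X) :
    quadForm (tensorDiag ρ (pureState s)) (embedKet s u) = quadForm ρ u := by
  classical
  rw [quadForm_tensorDiag hρ (pureState_nonneg s) (hasSum_fintype _).summable, tsum_eq_single s]
  · rw [adjoint_embedKet_embedKet, if_pos rfl]
    simp [pureState]
  · intro t ht
    simp [pureState, ht]

section Unitary

variable {Z : Type*} {U : Op Z}

theorem hasSum_adjoint_apply (U : Op Z) (w : HilbertSpace Z) (z : Z) :
    HasSum (fun y => inner ℂ (matElem U y z) (w y)) (adjoint U w z) := by
  rw [← inner_ket_left, ContinuousLinearMap.adjoint_inner_right]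
  exact lp.hasSum_inner _ _

/-- A unitary commuting with the Hamiltonian preserves the expectation of functions of energy. -/
theorem tsum_mul_enorm_sq_adjoint (hU : U ∈ unitary (Op Z)) {G : Z → ℝ} (hG : ∀ z, 0 ≤ G z)
    (hG1 : ∀ z, G z ≤ 1) (hc : ∀ y z, G y ≠ G z → matElem U y z = 0) (w : HilbertSpace Z) :
    ∑' z, ENNReal.ofReal (G z) * ‖adjoint U w z‖ₑ ^ 2
      = ∑' z, ENNReal.ofReal (G z) * ‖w z‖ₑ ^ 2 := by
  -- The vector d is √G w. As U† commutes with √G and is isometric, ‖√G U† w‖ = ‖U† d‖ = ‖d‖.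
  obtain ⟨d, hd⟩ := exists_diagMul (fun z => √(G z)) (C := 1) (fun z => by
    rw [abs_of_nonneg (Real.sqrt_nonneg _)]
    exact Real.sqrt_le_one.2 (hG1 z)) w
  have hsq : ∀ (z : Z) (a : ℂ), ‖((√(G z) : ℝ) : ℂ) * a‖ₑ ^ 2 = ENNReal.ofReal (G z) * ‖a‖ₑ ^ 2 := by
    intro z a
    rw [← ofReal_norm_sq, ← ofReal_norm_sq, ← ENNReal.ofReal_mul (hG z), norm_mul, mul_pow,
      Complex.norm_real, Real.norm_of_nonneg (Real.sqrt_nonneg _), Real.sq_sqrt (hG z)]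
  have key : ∀ z, adjoint U d z = (√(G z) : ℝ) * adjoint U w z := by
    intro z
    rw [← (hasSum_adjoint_apply U d z).tsum_eq, ← (hasSum_adjoint_apply U w z).tsum_eq,
      ← tsum_mul_left]
    refine tsum_congr fun y => ?_
    rw [hd]
    by_cases h : G y = G z
    · rw [h, ← smul_eq_mul, inner_smul_right]
    · simp [hc y z h]
  calc _ = ∑' z, ‖adjoint U d z‖ₑ ^ 2 := by simp only [key, hsq]
    _ = ‖adjoint U d‖ₑ ^ 2 := (enorm_sq_eq_tsum _).symm
    _ = ‖d‖ₑ ^ 2 := by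
      rw [← ofReal_norm_sq, ← ofReal_norm_sq]
      congr 2
      exact ContinuousLinearMap.norm_map_of_mem_unitary (Unitary.star_mem hU) d
    _ = _ := by simp only [enorm_sq_eq_tsum d, hd, hsq]

end Unitary

/-- The expectation of the operator `∑ x, g x |x⟩⟨x|` in a family of vectors. -/
noncomputable def diagWeight {ι : Type*} (g : X → ℝ) (v : ι → HilbertSpace X) : ℝ≥0∞ :=
  ∑' i, ∑' x, ENNReal.ofReal (g x) * ‖v i x‖ₑ ^ 2

/-- The operator `∑ i, |v i⟩⟨v i|`, pulled back from the output to the input of a thermal operation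
which takes `ω ⊗ τ` to `ω' ⊗ |s₀⟩⟨s₀|` with a bath in the state `q`. -/
noncomputable def pullback {ι : Type*} (U : Op ((X × S) × B)) (τ : S → ℝ) (q : B → ℝ) (s₀ : S)
    (v : ι → HilbertSpace X) : ι × B × B × S → HilbertSpace X := fun k =>
  ((√(q k.2.2.1 * τ k.2.2.2) : ℝ) : ℂ) • adjoint (embedKet k.2.2.2)
    (adjoint (embedKet k.2.2.1) (adjoint U (embedKet k.2.1 (embedKet s₀ (v k.1)))))

section Pullback

variable {ι : Type*} {U : Op ((X × S) × B)} {τ : S → ℝ} {q : B → ℝ} {s₀ : S}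
  {v : ι → HilbertSpace X}

/-- Duality between states and tests. An index (i, b', b, s) records the test vector, the output
bath state, the input bath state and the input system state; the factor √(q b · τ s) carries the
input populations. -/
theorem tsum_quadForm_pullback [Fintype S] {ω ω' : Op X} (hω : ω.IsPositive) (hω' : ω'.IsPositive)
    (hτ : ∀ s, 0 ≤ τ s) (hq : ∀ b, 0 ≤ q b) (hqs : Summable q)
    (h : IsPartialTrace (U ∘L tensorDiag (tensorDiag ω τ) q ∘L adjoint U)
      (tensorDiag ω' (pureState s₀))) :
    ∑' k, quadForm ω (pullback U τ q s₀ v k) = ∑' i, quadForm ω' (v i) := by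
  rw [ENNReal.tsum_prod']
  refine tsum_congr fun i => ?_
  have hpos := isPositive_tensorDiag (isPositive_tensorDiag hω hτ) hq
  rw [← quadForm_tensorDiag_pureState hω' s₀ (v i), quadForm_eq_tsum h fun b =>
    ((hpos.conj_adjoint U).adjoint_conj (embedKet b)).2 _, ENNReal.tsum_prod']
  refine tsum_congr fun b' => ?_
  rw [quadForm_adjoint_comp, quadForm_comp_adjoint,
    quadForm_tensorDiag (isPositive_tensorDiag hω hτ) hq hqs, ENNReal.tsum_prod']
  refine tsum_congr fun b => ?_
  rw [quadForm_tensorDiag hω hτ (hasSum_fintype _).summable, ← ENNReal.tsum_mul_left]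
  refine tsum_congr fun s => ?_
  rw [pullback, quadForm_apply_smul, Real.sq_sqrt (mul_nonneg (hq b) (hτ s)),
    ENNReal.ofReal_mul (hq b), mul_assoc]

/-- The sum over i is controlled by the Bessel property of `v`, the sum over b' by Parseval and
unitarity of U, and the sums over b and s are averages with probability weights. -/
theorem IsBessel.pullback (hv : IsBessel v) (hU : U ∈ unitary (Op ((X × S) × B)))
    (hτ : ∀ s, 0 ≤ τ s) (hq : ∀ b, 0 ≤ q b) (hτ1 : ∑' s, ENNReal.ofReal (τ s) = 1)
    (hq1 : ∑' b, ENNReal.ofReal (q b) = 1) : IsBessel (pullback U τ q s₀ v) := by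
  intro u
  have hterm : ∀ i b' b s, ‖inner ℂ (ThermalEmbezzling.pullback U τ q s₀ v (i, b', b, s)) u‖ₑ ^ 2
      = ENNReal.ofReal (q b) * (ENNReal.ofReal (τ s) * ‖inner ℂ (v i) (adjoint (embedKet s₀)
        (adjoint (embedKet b') (U (embedKet b (embedKet s u)))))‖ₑ ^ 2) := by
    intro i b' b s
    simp only [ThermalEmbezzling.pullback]
    rw [inner_smul_left, Complex.conj_ofReal, ContinuousLinearMap.adjoint_inner_left,
      ContinuousLinearMap.adjoint_inner_left, ContinuousLinearMap.adjoint_inner_left,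
      ← ContinuousLinearMap.adjoint_inner_right, ← ContinuousLinearMap.adjoint_inner_right,
      ← mul_assoc, ← ENNReal.ofReal_mul (hq b), ← ofReal_norm_sq, ← ofReal_norm_sq,
      ← ENNReal.ofReal_mul (mul_nonneg (hq b) (hτ s)), norm_mul, mul_pow, Complex.norm_real,
      Real.norm_of_nonneg (Real.sqrt_nonneg _), Real.sq_sqrt (mul_nonneg (hq b) (hτ s))]
  have hbound : ∀ b s, ∑' i, ∑' b', ‖inner ℂ (v i) (adjoint (embedKet s₀)
        (adjoint (embedKet b') (U (embedKet b (embedKet s u)))))‖ₑ ^ 2 ≤ ‖u‖ₑ ^ 2 := by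
    intro b s
    rw [ENNReal.tsum_comm]
    calc _ ≤ ∑' b', ‖adjoint (embedKet b' : HilbertSpace (X × S) →L[ℂ] _)
            (U (embedKet b (embedKet s u)))‖ₑ ^ 2 := by
          refine ENNReal.tsum_le_tsum fun b' => (hv _).trans ?_
          rw [← tsum_enorm_adjoint_embedKet (adjoint (embedKet b') _)]
          exact ENNReal.le_tsum s₀
      _ = ‖u‖ₑ ^ 2 := by
          rw [tsum_enorm_adjoint_embedKet, ← ofReal_norm_sq, ← ofReal_norm_sq,
            ContinuousLinearMap.norm_map_of_mem_unitary hU, norm_embedKet, norm_embedKet]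
  calc _ = ∑' i, ∑' b', ∑' b, ∑' s, ENNReal.ofReal (q b) * (ENNReal.ofReal (τ s) *
        ‖inner ℂ (v i) (adjoint (embedKet s₀)
        (adjoint (embedKet b') (U (embedKet b (embedKet s u)))))‖ₑ ^ 2) := by
        simp only [ENNReal.tsum_prod', hterm]
    _ = ∑' b, ENNReal.ofReal (q b) * ∑' s, ENNReal.ofReal (τ s) * ∑' i, ∑' b',
        ‖inner ℂ (v i) (adjoint (embedKet s₀)
        (adjoint (embedKet b') (U (embedKet b (embedKet s u)))))‖ₑ ^ 2 := by
        simp only [← ENNReal.tsum_mul_left]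
        exact (tsum_congr fun i => ENNReal.tsum_comm).trans (ENNReal.tsum_comm.trans
          (tsum_congr fun b => (tsum_congr fun i => ENNReal.tsum_comm).trans ENNReal.tsum_comm))
    _ ≤ ∑' b, ENNReal.ofReal (q b) * ∑' s, ENNReal.ofReal (τ s) * ‖u‖ₑ ^ 2 := by
        gcongr
        exact hbound _ _
    _ = ‖u‖ₑ ^ 2 := by
        rw [ENNReal.tsum_mul_right, ENNReal.tsum_mul_right, hτ1, hq1, one_mul, one_mul]

/-- The weight g ⊗ τ ⊗ q is conserved by U†, so it can be evaluated on v i ⊗ |s₀⟩ ⊗ |b'⟩, where it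
factorizes; summing q over b' leaves the factor τ s₀. -/
theorem diagWeight_pullback (hU : U ∈ unitary (Op ((X × S) × B))) {g : X → ℝ} (hg : ∀ x, 0 ≤ g x)
    (hτ : ∀ s, 0 ≤ τ s) (hq : ∀ b, 0 ≤ q b) (hq1 : ∑' b, ENNReal.ofReal (q b) = 1)
    (hG1 : ∀ z : (X × S) × B, g z.1.1 * τ z.1.2 * q z.2 ≤ 1)
    (hc : ∀ y z : (X × S) × B, g y.1.1 * τ y.1.2 * q y.2 ≠ g z.1.1 * τ z.1.2 * q z.2 →
      matElem U y z = 0) :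
    diagWeight g (pullback U τ q s₀ v) = ENNReal.ofReal (τ s₀) * diagWeight g v := by
  classical
  rw [diagWeight, ENNReal.tsum_prod', diagWeight, ← ENNReal.tsum_mul_left]
  refine tsum_congr fun i => ?_
  have hb : ∀ b', ∑' k : B × S, ∑' x, ENNReal.ofReal (g x) *
      ‖pullback U τ q s₀ v (i, b', k) x‖ₑ ^ 2 =
      ENNReal.ofReal (q b') * (ENNReal.ofReal (τ s₀) *
        ∑' x, ENNReal.ofReal (g x) * ‖v i x‖ₑ ^ 2) := by
    intro b'
    have h1 := tsum_mul_enorm_sq_adjoint hU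
      (fun z => mul_nonneg (mul_nonneg (hg z.1.1) (hτ z.1.2)) (hq z.2)) hG1 hc
      (embedKet b' (embedKet s₀ (v i)))
    have h2 : ∑' z : (X × S) × B, ENNReal.ofReal (g z.1.1 * τ z.1.2 * q z.2) *
        ‖embedKet b' (embedKet s₀ (v i)) z‖ₑ ^ 2 =
        ENNReal.ofReal (q b') * (ENNReal.ofReal (τ s₀) *
          ∑' x, ENNReal.ofReal (g x) * ‖v i x‖ₑ ^ 2) := by
      rw [ENNReal.tsum_prod', ENNReal.tsum_prod', ← ENNReal.tsum_mul_left, ← ENNReal.tsum_mul_left]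
      refine tsum_congr fun x => ?_
      rw [tsum_eq_single s₀, tsum_eq_single b']
      · simp only [embedKet_apply, if_true]
        rw [ENNReal.ofReal_mul (mul_nonneg (hg x) (hτ s₀)), ENNReal.ofReal_mul (hg x)]
        ring
      · intro b hbb
        simp [embedKet_apply, hbb]
      · intro s hs
        simp [embedKet_apply, hs]
    rw [← h2, ← h1, ENNReal.tsum_prod', ENNReal.tsum_prod', ENNReal.tsum_prod']
    have h3 : ∀ b s x, ENNReal.ofReal (g x) * ‖pullback U τ q s₀ v (i, b', b, s) x‖ₑ ^ 2 =
        ENNReal.ofReal (g x * τ s * q b) *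
          ‖adjoint U (embedKet b' (embedKet s₀ (v i))) ((x, s), b)‖ₑ ^ 2 := by
      intro b s x
      have h4 : pullback U τ q s₀ v (i, b', b, s) x = ((√(q b * τ s) : ℝ) : ℂ) *
          adjoint U (embedKet b' (embedKet s₀ (v i))) ((x, s), b) := by
        rw [← adjoint_embedKet_apply, ← adjoint_embedKet_apply]
        rfl
      have h5 := mul_nonneg (hq b) (hτ s)
      rw [h4, ← ofReal_norm_sq, ← ofReal_norm_sq, ← ENNReal.ofReal_mul (hg x),
        ← ENNReal.ofReal_mul (mul_nonneg (mul_nonneg (hg x) (hτ s)) (hq b)), norm_mul, mul_pow,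
        Complex.norm_real, Real.norm_of_nonneg (Real.sqrt_nonneg _), Real.sq_sqrt h5]
      ring_nf
    simp only [h3]
    rw [ENNReal.tsum_comm]
    conv_lhs => enter [1, s]; rw [ENNReal.tsum_comm]
    rw [ENNReal.tsum_comm]
  rw [ENNReal.tsum_prod']
  simp only [hb]
  rw [ENNReal.tsum_mul_right, hq1, one_mul]

/-- The vector `u` is an eigenvector of the Hamiltonian `∑ x, E x |x⟩⟨x|`, or zero. -/
def HasLevel (E : X → ℝ) (u : HilbertSpace X) : Prop := ∃ e, ∀ x, u x ≠ 0 → E x = e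

theorem hasLevel_pullback {EX : X → ℝ} {ES : S → ℝ} {EB : B → ℝ}
    (hc : CommutesWithHamiltonian (fun z : (X × S) × B => jointEnergy EX ES z.1 + EB z.2) U)
    (hv : ∀ i, HasLevel EX (v i)) (k : ι × B × B × S) : HasLevel EX (pullback U τ q s₀ v k) := by
  classical
  obtain ⟨i, b', b, s⟩ := k
  obtain ⟨e, he⟩ := hv i
  -- Energy conservation fixes the catalyst level once the system and bath labels on both sides are
  -- fixed.
  refine ⟨e + ES s₀ + EB b' - ES s - EB b, fun x hx => ?_⟩
  have h1 : adjoint U (embedKet b' (embedKet s₀ (v i))) ((x, s), b) ≠ 0 := by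
    intro h0
    rw [← adjoint_embedKet_apply, ← adjoint_embedKet_apply] at h0
    apply hx
    change _ * _ = (0 : ℂ)
    rw [h0, mul_zero]
  by_contra hne
  apply h1
  rw [← (hasSum_adjoint_apply U _ _).tsum_eq]
  refine (tsum_congr fun y => ?_).trans tsum_zero
  obtain ⟨⟨x', s'⟩, c⟩ := y
  by_cases h : c = b' ∧ s' = s₀ ∧ v i x' ≠ 0
  · obtain ⟨rfl, rfl, h3⟩ := h
    rw [hc, inner_zero_left]
    have := he x' h3
    simp only [jointEnergy]
    intro h4
    apply hne
    linarith
  · have : embedKet b' (embedKet s₀ (v i)) ((x', s'), c) = 0 := by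
      rw [embedKet_apply, embedKet_apply]
      by_cases h1 : c = b' <;> by_cases h2 : s' = s₀ <;> simp_all
    rw [this, inner_zero_right]

end Pullback

end ThermalEmbezzling

/-! ### Gibbs weights, trace distance and iterated tests -/

namespace ThermalEmbezzling

variable {X S : Type*}

section Gibbs

variable {β : ℝ} {E : X → ℝ}

theorem partitionFn_pos [Nonempty X] (h : Summable fun x => Real.exp (-β * E x)) :
    0 < partitionFn β E :=
  h.tsum_pos (fun _ => (Real.exp_pos _).le) (Classical.arbitrary X) (Real.exp_pos _)

theorem gibbs_nonneg (x : X) : 0 ≤ gibbs β E x :=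
  div_nonneg (Real.exp_pos _).le (tsum_nonneg fun _ => (Real.exp_pos _).le)

theorem hasSum_gibbs [Nonempty X] (h : Summable fun x => Real.exp (-β * E x)) :
    HasSum (gibbs β E) 1 := by
  have h1 := h.hasSum.div_const (partitionFn β E)
  rwa [← partitionFn, div_self (partitionFn_pos h).ne'] at h1

theorem tsum_ofReal_gibbs [Nonempty X] (h : Summable fun x => Real.exp (-β * E x)) :
    ∑' x, ENNReal.ofReal (gibbs β E x) = 1 := by
  rw [← ENNReal.ofReal_tsum_of_nonneg gibbs_nonneg (hasSum_gibbs h).summable,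
    (hasSum_gibbs h).tsum_eq, ENNReal.ofReal_one]

theorem gibbs_le_one [Nonempty X] (h : Summable fun x => Real.exp (-β * E x)) (x : X) :
    gibbs β E x ≤ 1 :=
  le_hasSum (hasSum_gibbs h) x fun _ _ => gibbs_nonneg _

/-- Each Boltzmann factor is at least that of the top level, and there are at least two. This is
what makes every pullback halve the thermal weight. -/
theorem two_le_partitionFn_div [Fintype S] (hS : 2 ≤ Fintype.card S) (hβ : 0 < β) {ES : S → ℝ}
    {sMax : S} (hmax : ∀ s, ES s ≤ ES sMax) :
    2 ≤ partitionFn β ES / Real.exp (-β * ES sMax) := by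
  rw [le_div_iff₀ (Real.exp_pos _), partitionFn, tsum_fintype]
  calc 2 * Real.exp (-β * ES sMax) ≤ Fintype.card S * Real.exp (-β * ES sMax) := by
        gcongr
        exact_mod_cast hS
    _ = ∑ _s : S, Real.exp (-β * ES sMax) := by simp
    _ ≤ _ := Finset.sum_le_sum fun s _ => Real.exp_le_exp.2 (by nlinarith [hmax s])

end Gibbs

theorem hasSum_re_matElem {ω : Op X} (hω : IsDensity ω) :
    HasSum (fun x => (matElem ω x x).re) 1 := by
  simpa using Complex.hasSum_re hω.2

theorem re_matElem_nonneg {ω : Op X} (hω : ω.IsPositive) (x : X) : 0 ≤ (matElem ω x x).re := by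
  rw [matElem_eq_inner]
  exact hω.re_inner_nonneg_right (ket x)

theorem tsum_quadForm_ket {ω : Op X} (hω : IsDensity ω) : ∑' x, quadForm ω (ket x) = 1 := by
  simp only [quadForm_ket]
  rw [← ENNReal.ofReal_tsum_of_nonneg (re_matElem_nonneg hω.1) (hasSum_re_matElem hω).summable,
    (hasSum_re_matElem hω).tsum_eq, ENNReal.ofReal_one]

/-- The Jordan decomposition into positive and negative parts. -/
theorem exists_isPositive_sub_eq {H : Type*} [NormedAddCommGroup H] [InnerProductSpace ℂ H]
    [CompleteSpace H] {D : H →L[ℂ] H} (hD : IsSelfAdjoint D) :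
    ∃ P N : H →L[ℂ] H, P.IsPositive ∧ N.IsPositive ∧ P - N = D ∧ absOp D = P + N :=
  ⟨D⁺, D⁻, (ContinuousLinearMap.nonneg_iff_isPositive _).1 (CFC.posPart_nonneg D),
    (ContinuousLinearMap.nonneg_iff_isPositive _).1 (CFC.negPart_nonneg D),
    CFC.posPart_sub_negPart D hD, (CFC.posPart_add_negPart D hD).symm⟩

/-- The trace distance bounds the change of any measurement probability. -/
theorem IsBessel.tsum_quadForm_le_add_traceDist {ι : Type*} {v : ι → HilbertSpace X}
    (hv : IsBessel v) {ω ω' : Op X} (hω : IsDensity ω) (hω' : IsDensity ω') :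
    ∑' i, quadForm ω (v i) ≤ ∑' i, quadForm ω' (v i) + traceDist ω ω' := by
  set D := ω - ω' with hD
  have hsa : IsSelfAdjoint D := hω.1.isSelfAdjoint.sub hω'.1.isSelfAdjoint
  obtain ⟨P, N, hp, hn, hsub, habs⟩ := exists_isPositive_sub_eq hsa
  -- The identity is kept free of subtraction so that it can be evaluated in `ℝ≥0∞`. Equality of the
  -- traces of ω and ω' then gives tr N = tr P, which is the trace distance.
  have heq : ω + N = ω' + P := by
    rw [hD, sub_eq_sub_iff_add_eq_add] at hsub
    rw [add_comm ω', hsub]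
  have htr : ∑' x, quadForm N (ket x) = ∑' x, quadForm P (ket x) := by
    have h : ∑' x, quadForm (ω + N) (ket x) = ∑' x, quadForm (ω' + P) (ket x) := by rw [heq]
    simp only [quadForm_add hω.1 hn, quadForm_add hω'.1 hp, ENNReal.tsum_add,
      tsum_quadForm_ket hω, tsum_quadForm_ket hω'] at h
    exact (ENNReal.add_right_inj ENNReal.one_ne_top).1 h
  have hnorm : traceDist ω ω' = ∑' x, quadForm P (ket x) := by
    rw [traceDist, traceNorm, ← hD]
    simp only [← quadForm_ket, habs, quadForm_add hp hn]
    rw [ENNReal.tsum_add, htr, ← two_mul, mul_comm,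
      ENNReal.mul_div_cancel_right two_ne_zero ENNReal.ofNat_ne_top]
  calc ∑' i, quadForm ω (v i) ≤ ∑' i, quadForm (ω' + P) (v i) := by
        refine ENNReal.tsum_le_tsum fun i => quadForm_mono ?_ _
        rw [← heq]
        exact le_add_of_nonneg_right ((ContinuousLinearMap.nonneg_iff_isPositive _).2 hn)
    _ = ∑' i, quadForm ω' (v i) + ∑' i, quadForm P (v i) := by
        simp only [quadForm_add hω'.1 hp, ENNReal.tsum_add]
    _ ≤ _ := by
        rw [hnorm]
        gcongr
        exact hv.tsum_quadForm_le_trace hp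

/-- Iterating a transition `ω ⊗ τ → ω' ⊗ |s₀⟩⟨s₀|` on tests yields a test of small thermal weight
which the initial state `ω` passes with high probability. -/
theorem exists_isBessel_diagWeight_eq.{u} {S : Type u} [Fintype S] {β : ℝ} {EC : ℕ → ℝ} {ES : S → ℝ}
    {s₀ : S} (hZ : Summable fun j => Real.exp (-β * EC j)) {ω ω' : Op ℕ} (hω : IsDensity ω)
    (hω' : IsDensity ω') (h : ThermalTransition β (jointEnergy EC ES) (tensorDiag ω (gibbs β ES))
      (tensorDiag ω' (pureState s₀))) (n : ℕ) :
    ∃ (ι : Type u) (v : ι → HilbertSpace ℕ), IsBessel v ∧ (∀ i, HasLevel EC (v i)) ∧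
      diagWeight (gibbs β EC) v = ENNReal.ofReal (gibbs β ES s₀) ^ n ∧
      1 ≤ ∑' i, quadForm ω (v i) + n * traceDist ω ω' := by
  classical
  have : Nonempty S := ⟨s₀⟩
  obtain ⟨B, hB, EB, hEB, U, hU, hc, hT⟩ := h
  have hZS : Summable fun s => Real.exp (-β * ES s) := (hasSum_fintype _).summable
  induction n with
  | zero =>
    -- The identity test. The lift only places the index type in the universe of the later products
    -- with S.
    refine ⟨ULift.{u} ℕ, fun i => ket i.down, ?_, fun i => ⟨EC i.down, fun x hx => ?_⟩, ?_, ?_⟩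
    · exact fun u => (Equiv.ulift.tsum_eq fun i : ℕ => ‖inner ℂ (ket i) u‖ₑ ^ 2).trans_le
        (isBessel_ket u)
    · rw [ket_apply] at hx
      by_contra hne
      exact hx (if_neg fun h => hne (by rw [h]))
    · rw [pow_zero, ← tsum_ofReal_gibbs hZ]
      refine (Equiv.ulift.tsum_eq fun i : ℕ =>
        ∑' x, ENNReal.ofReal (gibbs β EC x) * ‖(ket i : HilbertSpace ℕ) x‖ₑ ^ 2).trans ?_
      refine tsum_congr fun i => ?_
      rw [tsum_eq_single i]
      · simp [ket_apply]
      · intro x hx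
        simp [ket_apply, hx]
    · refine le_trans (le_of_eq ?_) le_self_add
      exact ((Equiv.ulift.tsum_eq fun i : ℕ => quadForm ω (ket i)).trans (tsum_quadForm_ket hω)).symm
  | succ n ih =>
    obtain ⟨ι, v, hv, hl, hw, h1⟩ := ih
    refine ⟨_, pullback U (gibbs β ES) (gibbs β EB) s₀ v,
      hv.pullback hU gibbs_nonneg gibbs_nonneg (tsum_ofReal_gibbs hZS) (tsum_ofReal_gibbs hEB),
      hasLevel_pullback hc hl, ?_, ?_⟩
    · rw [diagWeight_pullback hU gibbs_nonneg gibbs_nonneg gibbs_nonneg (tsum_ofReal_gibbs hEB)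
        ?_ ?_, hw, pow_succ']
      · intro z
        exact mul_le_one₀ (mul_le_one₀ (gibbs_le_one hZ _) (gibbs_nonneg _) (gibbs_le_one hZS _))
          (gibbs_nonneg _) (gibbs_le_one hEB _)
      · intro y z hyz
        refine hc y z fun he => hyz ?_
        -- A product of Gibbs weights at the same β depends only on the total energy.
        have hG : ∀ z : (ℕ × S) × B, gibbs β EC z.1.1 * gibbs β ES z.1.2 * gibbs β EB z.2 =
            Real.exp (-β * (jointEnergy EC ES z.1 + EB z.2)) /
              (partitionFn β EC * partitionFn β ES * partitionFn β EB) := by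
          intro z
          rw [gibbs, gibbs, gibbs, div_mul_div_comm, div_mul_div_comm, ← Real.exp_add,
            ← Real.exp_add, jointEnergy]
          ring_nf
        rw [hG, hG]
        exact congrArg (fun E => Real.exp (-β * E) / _) he
    · rw [tsum_quadForm_pullback hω.1 hω'.1 gibbs_nonneg gibbs_nonneg (hasSum_gibbs hEB).summable hT]
      refine h1.trans ?_
      calc _ ≤ (∑' i, quadForm ω' (v i) + traceDist ω ω') + n * traceDist ω ω' := by
            gcongr
            exact hv.tsum_quadForm_le_add_traceDist hω hω'
        _ = _ := by push_cast; ring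

/-! ### Energy bound against thermal weight -/

theorem lt_apply_cutoff_succ {EC : ℕ → ℝ} (h : Tendsto EC atTop atTop) (e W : ℝ) :
    e / (1 - W) < EC (cutoff EC e W + 1) :=
  -- Unboundedness of the spectrum makes the set nonempty, so `sInf` is a true minimum and not the
  -- default 0.
  Nat.sInf_mem (s := {k | e / (1 - W) < EC (k + 1)})
    ((h.comp (tendsto_add_atTop_nat 1)).eventually_gt_atTop _).exists

/-- Markov's inequality for the energy. -/
theorem tsum_indicator_quadForm_le {EC : ℕ → ℝ} (hmono : Monotone EC) (hnonneg : ∀ j, 0 ≤ EC j)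
    {e W : ℝ} (hW : W < 1) {J : ℕ} (hJ : e / (1 - W) < EC (J + 1)) {ω : Op ℕ} (hω : IsDensity ω)
    (hE : MeanEnergyLE EC ω e) :
    ∑' x, (Set.Ioi J).indicator (fun x => quadForm ω (ket x)) x ≤ ENNReal.ofReal (1 - W) := by
  have hp := re_matElem_nonneg hω.1
  have hs := (hasSum_re_matElem hω).summable
  have he : 0 ≤ e := (tsum_nonneg fun x => mul_nonneg (hnonneg x) (hp x)).trans hE.2
  have hc : 0 < EC (J + 1) := (div_nonneg he (sub_nonneg.2 hW.le)).trans_lt hJ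
  have h1 : EC (J + 1) * ∑' x, (Set.Ioi J).indicator (fun x => (matElem ω x x).re) x ≤ e := by
    rw [← tsum_mul_left]
    refine ((hs.indicator _).mul_left _ |>.tsum_le_tsum (fun x => ?_) hE.1).trans hE.2
    by_cases hx : x ∈ Set.Ioi J
    · rw [Set.indicator_of_mem hx]
      exact mul_le_mul_of_nonneg_right (hmono hx) (hp x)
    · rw [Set.indicator_of_notMem hx, mul_zero]
      exact mul_nonneg (hnonneg x) (hp x)
  have h2 : ∑' x, (Set.Ioi J).indicator (fun x => (matElem ω x x).re) x ≤ 1 - W := by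
    rw [div_lt_iff₀ (sub_pos.2 hW)] at hJ
    exact (mul_le_mul_iff_right₀ hc).1 (h1.trans hJ.le)
  refine le_trans (le_of_eq ?_) (ENNReal.ofReal_le_ofReal h2)
  rw [ENNReal.ofReal_tsum_of_nonneg (fun x => Set.indicator_nonneg (fun x _ => hp x) x)
    (hs.indicator _)]
  refine tsum_congr fun x => ?_
  by_cases hx : x ∈ Set.Ioi J
  · rw [Set.indicator_of_mem hx, Set.indicator_of_mem hx, quadForm_ket]
  · simp [hx]

/-- A state of bounded energy passes a test of small thermal weight with bounded probability. -/
theorem IsBessel.tsum_quadForm_le_diagWeight {ι : Type*} {v : ι → HilbertSpace ℕ}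
    (hv : IsBessel v) {β : ℝ} (hβ : 0 < β) {EC : ℕ → ℝ} (hl : ∀ i, HasLevel EC (v i))
    (hmono : Monotone EC) (hnonneg : ∀ j, 0 ≤ EC j)
    (hZ : Summable fun j => Real.exp (-β * EC j)) {e W : ℝ} (hW : W < 1) {J : ℕ}
    (hJ : e / (1 - W) < EC (J + 1)) {ω : Op ℕ} (hω : IsDensity ω) (hE : MeanEnergyLE EC ω e) :
    ∑' i, quadForm ω (v i)
      ≤ diagWeight (gibbs β EC) v / ENNReal.ofReal (gibbs β EC J) + ENNReal.ofReal (1 - W) := by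
  classical
  -- A vector that is not `high` has a nonzero coordinate at some level up to J. Being an
  -- eigenvector, it then has energy at most `EC J` on its whole support, even if degeneracy puts
  -- indices above J there.
  let high : ι → Prop := fun i => ∀ x ∉ Set.Ioi J, v i x = 0
  let w : ι → HilbertSpace ℕ := fun i => if high i then v i else 0
  have hg0 : 0 < gibbs β EC J := div_pos (Real.exp_pos _) (partitionFn_pos hZ)
  have hwB : IsBessel w := fun u => by
    refine (ENNReal.tsum_le_tsum fun i => ?_).trans (hv u)
    simp only [w]
    split_ifs <;> simp
  have hws : ∀ i, ∀ x ∉ Set.Ioi J, w i x = 0 := by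
    intro i x hx
    simp only [w]
    split_ifs with h
    · exact h x hx
    · rfl
  have hlow : ∀ i, quadForm ω (v i) ≤ (∑' x, ENNReal.ofReal (gibbs β EC x) * ‖v i x‖ₑ ^ 2) /
      ENNReal.ofReal (gibbs β EC J) + quadForm ω (w i) := by
    intro i
    by_cases h : high i
    · simp only [w, if_pos h]
      exact le_add_self
    · refine le_trans ?_ le_self_add
      have h1 := quadForm_le_trace_mul hω.1 (v i)
      rw [tsum_quadForm_ket hω, one_mul] at h1
      refine h1.trans ?_
      rw [ENNReal.le_div_iff_mul_le (Or.inl (ENNReal.ofReal_pos.2 hg0).ne')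
        (Or.inl ENNReal.ofReal_ne_top), enorm_sq_eq_tsum, mul_comm, ← ENNReal.tsum_mul_left]
      refine ENNReal.tsum_le_tsum fun x => ?_
      by_cases hx : v i x = 0
      · simp [hx]
      · gcongr
        obtain ⟨a, ha⟩ := hl i
        simp only [high, not_forall] at h
        obtain ⟨y, hy, hvy⟩ := h
        have hle : EC x ≤ EC J := by
          rw [ha x hx, ← ha y hvy]
          exact hmono (not_lt.1 hy)
        refine div_le_div_of_nonneg_right (Real.exp_le_exp.2 ?_) (partitionFn_pos hZ).le
        nlinarith
  calc _ ≤ _ := ENNReal.tsum_le_tsum hlow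
    _ = diagWeight (gibbs β EC) v / ENNReal.ofReal (gibbs β EC J) + ∑' i, quadForm ω (w i) := by
        rw [ENNReal.tsum_add, diagWeight]
        simp only [div_eq_mul_inv, ENNReal.tsum_mul_right]
    _ ≤ _ := by
        gcongr
        exact (hwB.tsum_quadForm_le hω.1 _ hws).trans
          (tsum_indicator_quadForm_le hmono hnonneg hW hJ hω hE)

/-- If `W ≤ n d + 2⁻ⁿ / g` for all `n`, then `d` is at least of order `W² g`. -/
theorem sq_mul_le_of_forall_le {W g d : ℝ} (hW : 0 < W) (hg : 0 < g) (hWg : W * g ≤ 1)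
    (h : ∀ n : ℕ, W ≤ n * d + (1 / 2) ^ n / g) : W ^ 2 * g ≤ 8 * d := by
  by_contra! hd
  have hy : 0 < W * g := by positivity
  have hex : ∃ n : ℕ, 2 / (W * g) ≤ 2 ^ n :=
    (pow_unbounded_of_one_lt _ one_lt_two).imp fun _ => le_of_lt
  -- The least n with 2ⁿ ≥ 2/(W g): this makes 2⁻ⁿ/g ≤ W/2, while minimality keeps 2ⁿ within a
  -- factor 2. If n = 0 the upper bound comes from W g ≤ 1.
  obtain ⟨n, hn, hmin⟩ : ∃ n : ℕ, 2 / (W * g) ≤ 2 ^ n ∧ W * g * 2 ^ n ≤ 4 := by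
    classical
    refine ⟨Nat.find hex, Nat.find_spec hex, ?_⟩
    rcases hk : Nat.find hex with _ | k
    · rw [pow_zero]
      linarith
    · have := Nat.find_min hex (m := k) (by omega)
      rw [not_le, lt_div_iff₀ hy] at this
      rw [pow_succ]
      linarith
  have h2 : (0 : ℝ) < 2 ^ n := by positivity
  -- This crude bound replaces the logarithmic size of n and costs one power of W g in the final
  -- estimate.
  have hn2 : (n : ℝ) < 2 ^ n := by exact_mod_cast Nat.lt_two_pow_self
  have h3 : (1 / 2 : ℝ) ^ n / g ≤ W / 2 := by
    rw [div_le_iff₀ hy] at hn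
    rw [div_le_iff₀ hg, div_pow, one_pow, div_le_iff₀ h2]
    linarith
  have h4 : n * d < W / 2 ∨ n = 0 := by
    rcases Nat.eq_zero_or_pos n with h0 | h0
    · exact Or.inr h0
    · left
      have hn0 : (0 : ℝ) < n := by exact_mod_cast h0
      have h5 : n * (8 * d) < n * (W ^ 2 * g) := by gcongr
      have h6 : n * (W ^ 2 * g) ≤ 2 ^ n * (W ^ 2 * g) := by gcongr
      have h7 : 2 ^ n * (W ^ 2 * g) ≤ W * 4 := by
        calc _ = W * (W * g * 2 ^ n) := by ring
          _ ≤ _ := by gcongr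
      linarith
  have h8 := h n
  rcases h4 with h4 | rfl
  · linarith
  · rw [Nat.cast_zero, zero_mul, zero_add] at h8
    linarith

theorem sq_mul_gibbs_le_traceDist [Fintype S] (hS : 2 ≤ Fintype.card S) {β : ℝ} (hβ : 0 < β)
    {ES : S → ℝ} {sMax : S} (hmax : ∀ s, ES s ≤ ES sMax) {EC : ℕ → ℝ} (hmono : Monotone EC)
    (hnonneg : ∀ j, 0 ≤ EC j) (hunbounded : Tendsto EC atTop atTop)
    (hZ : Summable fun j => Real.exp (-β * EC j)) {e : ℝ} {ω ω' : Op ℕ} (hω : IsDensity ω)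
    (hω' : IsDensity ω') (hE : MeanEnergyLE EC ω e)
    (h : ThermalTransition β (jointEnergy EC ES) (tensorDiag ω (gibbs β ES))
      (tensorDiag ω' (pureState sMax))) (hd : traceDist ω ω' ≠ ∞) {W : ℝ} (hW0 : 0 < W)
    (hW1 : W < 1) :
    W ^ 2 * gibbs β EC (cutoff EC e W) ≤ 8 * (traceDist ω ω').toReal := by
  have hg0 : 0 < gibbs β EC (cutoff EC e W) := div_pos (Real.exp_pos _) (partitionFn_pos hZ)
  refine sq_mul_le_of_forall_le hW0 hg0 (mul_le_one₀ hW1.le hg0.le (gibbs_le_one hZ _)) fun n => ?_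
  obtain ⟨ι, v, hv, hl, hw, h1⟩ := exists_isBessel_diagWeight_eq hZ hω hω' h n
  have h2 := hv.tsum_quadForm_le_diagWeight hβ hl hmono hnonneg hZ hW1
    (lt_apply_cutoff_succ hunbounded e W) hω hE
  have ha : gibbs β ES sMax ≤ 1 / 2 := by
    have h3 := two_le_partitionFn_div hS hβ hmax
    rw [gibbs, ← inv_div, one_div]
    exact inv_anti₀ two_pos h3
  have ha0 : 0 ≤ gibbs β ES sMax := gibbs_nonneg _
  rw [hw, ← ENNReal.ofReal_pow ha0, ← ENNReal.ofReal_div_of_pos hg0, ← ENNReal.ofReal_add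
    (by positivity) (by linarith)] at h2
  have h3 : (1 : ℝ≥0∞) ≤ ENNReal.ofReal (gibbs β ES sMax ^ n / gibbs β EC (cutoff EC e W) + (1 - W)
      + n * (traceDist ω ω').toReal) := by
    rw [ENNReal.ofReal_add (add_nonneg (by positivity) (by linarith)) (by positivity),
      ENNReal.ofReal_mul (by positivity), ENNReal.ofReal_toReal hd, ENNReal.ofReal_natCast]
    exact h1.trans (by gcongr)
  have h4 := ENNReal.one_le_ofReal.1 h3
  have h5 : gibbs β ES sMax ^ n / gibbs β EC (cutoff EC e W)
      ≤ (1 / 2) ^ n / gibbs β EC (cutoff EC e W) := by gcongr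
  linarith

/-! ### The supremum over W and the final constants -/

section EpsC

variable {β : ℝ} {EC : ℕ → ℝ}

/-- The family is bounded by 1 because energies are nonnegative and γ < 1; without boundedness the
real supremum would be the default 0. -/
theorem mul_rpow_le_epsC (hβ : 0 < β) (hnonneg : ∀ j, 0 ≤ EC j) (e : ℝ)
    (W : Set.Ioo (0 : ℝ) 1) : (W : ℝ) * Real.exp (-β / 2) ^ EC (cutoff EC e W) ≤ epsC β EC e := by
  refine le_ciSup (f := fun W : Set.Ioo (0 : ℝ) 1 =>
    (W : ℝ) * Real.exp (-β / 2) ^ EC (cutoff EC e W)) ⟨1, ?_⟩ W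
  rintro _ ⟨V, rfl⟩
  exact mul_le_one₀ V.2.2.le (Real.rpow_nonneg (Real.exp_pos _).le _)
    (Real.rpow_le_one (Real.exp_pos _).le (Real.exp_le_one_iff.2 (by linarith)) (hnonneg _))

theorem epsC_pos (hβ : 0 < β) (hnonneg : ∀ j, 0 ≤ EC j) (e : ℝ) : 0 < epsC β EC e :=
  lt_of_lt_of_le (by positivity)
    (mul_rpow_le_epsC hβ hnonneg e ⟨1 / 2, by norm_num, by norm_num⟩)

theorem epsC_sq_le {e C : ℝ} (hβ : 0 < β) (hnonneg : ∀ j, 0 ≤ EC j)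
    (h : ∀ W : ℝ, 0 < W → W < 1 → W ^ 2 * Real.exp (-β * EC (cutoff EC e W)) ≤ C) :
    epsC β EC e ^ 2 ≤ C := by
  have hne : Nonempty (Set.Ioo (0 : ℝ) 1) := ⟨⟨1 / 2, by norm_num, by norm_num⟩⟩
  have hC : 0 ≤ C := le_trans (by positivity) (h (1 / 2) (by norm_num) (by norm_num))
  have h1 : epsC β EC e ≤ √C := by
    refine ciSup_le fun W => Real.le_sqrt_of_sq_le ?_
    have h2 : (Real.exp (-β / 2) ^ EC (cutoff EC e W)) ^ 2
        = Real.exp (-β * EC (cutoff EC e W)) := by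
      rw [← Real.exp_mul, ← Real.exp_nat_mul]
      congr 1
      push_cast
      ring
    rw [mul_pow, h2]
    exact h W W.2.1 W.2.2
  exact (pow_le_pow_left₀ (epsC_pos hβ hnonneg e).le h1 2).trans_eq (Real.sq_sqrt hC)

end EpsC

theorem f_pos {a : ℝ} (ha : a ≠ 0) : 0 < f a := by
  unfold f
  positivity

/-- All that the lower bound on the trace distance needs from f, besides f ≥ 0. -/
theorem f_le_half (a : ℝ) : f a ≤ 1 / 2 := by
  rw [f, div_le_div_iff₀ (by positivity) two_pos]
  linarith

theorem errorBound_pos [Fintype S] (hS : 2 ≤ Fintype.card S) {β : ℝ} (hβ : 0 < β) {ES : S → ℝ}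
    {sMax : S} (hmax : ∀ s, ES s ≤ ES sMax) {EC : ℕ → ℝ} (hnonneg : ∀ j, 0 ≤ EC j)
    (hZ : Summable fun j => Real.exp (-β * EC j)) (e : ℝ) : 0 < errorBound β EC ES sMax e := by
  have h1 := epsC_pos hβ hnonneg e
  have h2 := partitionFn_pos hZ
  have h3 := f_pos (zero_lt_two.trans_le (two_le_partitionFn_div hS hβ hmax)).ne'
  unfold errorBound
  positivity

theorem errorBound_le_traceDist [Fintype S] (hS : 2 ≤ Fintype.card S) {β : ℝ} (hβ : 0 < β)
    {ES : S → ℝ} {sMax : S} (hmax : ∀ s, ES s ≤ ES sMax) {EC : ℕ → ℝ} (hmono : Monotone EC)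
    (hnonneg : ∀ j, 0 ≤ EC j) (hunbounded : Tendsto EC atTop atTop)
    (hZ : Summable fun j => Real.exp (-β * EC j)) {e : ℝ} {ω ω' : Op ℕ} (hω : IsDensity ω)
    (hω' : IsDensity ω') (hE : MeanEnergyLE EC ω e)
    (h : ThermalTransition β (jointEnergy EC ES) (tensorDiag ω (gibbs β ES))
      (tensorDiag ω' (pureState sMax))) :
    ENNReal.ofReal (errorBound β EC ES sMax e) ≤ traceDist ω ω' := by
  by_cases hd : traceDist ω ω' = ∞
  · rw [hd]
    exact le_top
  have hZ0 := partitionFn_pos hZ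
  set d := (traceDist ω ω').toReal with hdd
  have heps : epsC β EC e ^ 2 ≤ 8 * d * partitionFn β EC := epsC_sq_le hβ hnonneg fun W h0 h1 => by
    have h2 := sq_mul_gibbs_le_traceDist hS hβ hmax hmono hnonneg hunbounded hZ hω hω' hE h hd h0 h1
    rwa [gibbs, ← mul_div_assoc, div_le_iff₀ hZ0] at h2
  rw [ENNReal.ofReal_le_iff_le_toReal hd, ← hdd, errorBound]
  set a := partitionFn β ES / Real.exp (-β * ES sMax)
  have hf : f a ^ 2 ≤ (1 / 2) ^ 2 :=
    pow_le_pow_left₀ (by unfold f; positivity) (f_le_half a) 2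
  have h3 : f a ^ 2 * epsC β EC e ^ 2 / partitionFn β EC ≤ 2 * d := by
    rw [div_le_iff₀ hZ0]
    -- The constants match exactly: f² ≤ 1/4 turns 8 d into 2 d, and the prefactor 1/2 of the error
    -- bound leaves d.
    calc _ ≤ (1 / 2) ^ 2 * (8 * d * partitionFn β EC) := by gcongr
      _ = _ := by ring
  linarith

theorem isProbability_gibbs [Fintype S] [Nonempty S] (β : ℝ) (ES : S → ℝ) :
    IsProbability (gibbs β ES) :=
  ⟨gibbs_nonneg, (hasSum_fintype _).unique (hasSum_gibbs (hasSum_fintype _).summable)⟩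

theorem isProbability_pureState [Fintype S] (s : S) : IsProbability (pureState s) := by
  classical
  refine ⟨pureState_nonneg s, ?_⟩
  simp [pureState]

end ThermalEmbezzling

theorem mainTheorem2 {S : Type*} [Fintype S] (hS : 2 ≤ Fintype.card S)
    (β : ℝ) (hβ : 0 < β)
    -- system Hamiltonian, with a level of maximal energy
    (ES : S → ℝ) (sMax : S) (hmax : ∀ s, ES s ≤ ES sMax)
    -- catalyst Hamiltonian
    (EC : ℕ → ℝ) (hmono : Monotone EC) (hnonneg : ∀ j, 0 ≤ EC j)
    (hunbounded : Tendsto EC atTop atTop) (hZ : Summable fun j => Real.exp (-β * EC j))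
    -- bound on the mean energy
    (E : ℝ) :
    0 < ThermalEmbezzling.errorBound β EC ES sMax E ∧
    (∀ ω ω' : ThermalEmbezzling.Op ℕ,
      ThermalEmbezzling.IsDensity ω → ThermalEmbezzling.IsDensity ω' →
      ThermalEmbezzling.MeanEnergyLE EC ω E →
      ThermalEmbezzling.ThermalTransition β (ThermalEmbezzling.jointEnergy EC ES)
        (ThermalEmbezzling.tensorDiag ω (ThermalEmbezzling.gibbs β ES))
        (ThermalEmbezzling.tensorDiag ω' (ThermalEmbezzling.pureState sMax)) →
      ENNReal.ofReal (ThermalEmbezzling.errorBound β EC ES sMax E)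
        ≤ ThermalEmbezzling.traceDist ω ω') ∧
    -- arbitrarily accurate embezzling of diagonal states is impossible
    ¬ ∀ δ : ℝ, 0 < δ → ∃ ω ω' : ThermalEmbezzling.Op ℕ,
      ThermalEmbezzling.IsDensity ω ∧ ThermalEmbezzling.IsDensity ω' ∧
      ThermalEmbezzling.MeanEnergyLE EC ω E ∧
      ThermalEmbezzling.traceDist ω ω' < ENNReal.ofReal δ ∧
      ∀ p p' : S → ℝ, ThermalEmbezzling.IsProbability p → ThermalEmbezzling.IsProbability p' →
        ThermalEmbezzling.ThermalTransition β (ThermalEmbezzling.jointEnergy EC ES)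
          (ThermalEmbezzling.tensorDiag ω p) (ThermalEmbezzling.tensorDiag ω' p') := by
  have hpos := ThermalEmbezzling.errorBound_pos hS hβ hmax hnonneg hZ E
  have hbound : ∀ ω ω' : ThermalEmbezzling.Op ℕ, ThermalEmbezzling.IsDensity ω →
      ThermalEmbezzling.IsDensity ω' → ThermalEmbezzling.MeanEnergyLE EC ω E →
      ThermalEmbezzling.ThermalTransition β (ThermalEmbezzling.jointEnergy EC ES)
        (ThermalEmbezzling.tensorDiag ω (ThermalEmbezzling.gibbs β ES))
        (ThermalEmbezzling.tensorDiag ω' (ThermalEmbezzling.pureState sMax)) →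
      ENNReal.ofReal (ThermalEmbezzling.errorBound β EC ES sMax E)
        ≤ ThermalEmbezzling.traceDist ω ω' := fun _ _ hω hω' hE h =>
    ThermalEmbezzling.errorBound_le_traceDist hS hβ hmax hmono hnonneg hunbounded hZ hω hω' hE h
  refine ⟨hpos, hbound, fun hall => ?_⟩
  have : Nonempty S := ⟨sMax⟩
  -- Take δ to be the error bound itself; embezzling would include the transition from the Gibbs
  -- state to the top level.
  obtain ⟨ω, ω', hω, hω', hE, hlt, h⟩ := hall _ hpos
  exact (hbound ω ω' hω hω' hE (h _ _ (ThermalEmbezzling.isProbability_gibbs β ES)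
    (ThermalEmbezzling.isProbability_pureState sMax))).not_gt hlt
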